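/- A finite hypergraph $H=(V,E)$ is $k$-uniform if all its hyperedges have exactly $k$ vertices. It is (weakly) $m$-colorable if its vertices can be colored with $m$ colors so that no hyperedge is monochromatic; its (weak) chromatic number $\chi(H)$ is the smallest $m$ such that $H$ is $m$-colorable. A $k$-uniform hypergraph $H=(V,E)$ is geometrically embeddable in $\mathbb{R}^d$ if there is an injective map $\phi:V\to\mathbb{R}^d$ such that $\dim\operatorname{aff}(\phi(e))=k-1$ for every $e\in E$, and $\operatorname{conv}(\phi(e_1))\cap\operatorname{conv}(\phi(e_2))=\operatorname{conv}(\phi(e_1)\cap\phi(e_2))$ for all $e_1,e_2\in E$. An abstract simplicial complex is geometrically embeddable in $\mathbb{R}^d$ if it is isomorphic to a geometric simplicial complex in $\mathbb{R}^d$. For $2\le k\le d+1$ let $\chi_L(k,d)$ be the supremum of $\chi(H)$ over all finite $k$-uniform hypergraphs $H$ that form the collection of maximal faces of a simplicial complex that is geometrically embeddable in $\mathbb{R}^d$. Theorem. For every odd $d\ge 3$, $\chi_L(d+1,d)\ge 3$. Moreover, there is a finite $(d+1)$-uniform hypergraph $L_d$ that is geometrically embeddable in $\mathbb{R}^d$ and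 is not $2$-colorable. -/

import Mathlib

namespace Hypergraph

/-- `H` is finite: it has finitely many vertices (hence finitely many hyperedges). -/
def IsFinite {α : Type*} (H : Hypergraph α) : Prop :=
  H.vertexSet.Finite

/-- `H` is `k`-uniform: every hyperedge has exactly `k` vertices. -/
def IsUniform {α : Type*} (H : Hypergraph α) (k : ℕ) : Prop :=
  ∀ e ∈ H.edgeSet, e.encard = k

/-- `H` is (weakly) `m`-colorable: the vertices can be colored with `m` colors so that no
hyperedge is monochromatic, i.e. every hyperedge contains two vertices of different colors. -/
def WeaklyColorable {α : Type*} (H : Hypergraph α) (m : ℕ) : Prop :=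
  ∃ c : H.vertexSet → Fin m, ∀ e ∈ H.edgeSet,
    ∃ u v : H.vertexSet, (u : α) ∈ e ∧ (v : α) ∈ e ∧ c u ≠ c v

/-- The (weak) chromatic number of `H`: the least `m` such that `H` is (weakly) `m`-colorable
(`⊤` if there is no such `m`). -/
noncomputable def weakChromaticNumber {α : Type*} (H : Hypergraph α) : ℕ∞ :=
  ⨅ m ∈ {m : ℕ | H.WeaklyColorable m}, (m : ℕ∞)

/-- A `k`-uniform hypergraph `H` is geometrically embeddable in `ℝ^d`: there is an injective
placement `φ` of the vertices in `ℝ^d` such that, for every hyperedge `e`, the affine hull of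
`φ(e)` has dimension `k - 1`, and any two hyperedges satisfy
`conv φ(e₁) ∩ conv φ(e₂) = conv (φ(e₁) ∩ φ(e₂))`. -/
def GeometricallyEmbeddable {α : Type*} (H : Hypergraph α) (k d : ℕ) : Prop :=
  ∃ φ : α → EuclideanSpace ℝ (Fin d), Set.InjOn φ H.vertexSet ∧
    (∀ e ∈ H.edgeSet, Module.finrank ℝ (affineSpan ℝ (φ '' e)).direction + 1 = k) ∧
    ∀ e₁ ∈ H.edgeSet, ∀ e₂ ∈ H.edgeSet,
      convexHull ℝ (φ '' e₁) ∩ convexHull ℝ (φ '' e₂) = convexHull ℝ (φ '' e₁ ∩ φ '' e₂)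

end Hypergraph

namespace PreAbstractSimplicialComplex

/-- The vertex set of an abstract simplicial complex. -/
def vertexSet {α : Type*} (K : PreAbstractSimplicialComplex α) : Set α :=
  {v | {v} ∈ K.faces}

/-- `K` is geometrically (linearly) embeddable in `ℝ^d`: it is isomorphic to a geometric
simplicial complex in `ℝ^d`, by an injective map of its vertices. -/
def GeometricallyEmbeddable {α : Type*} (K : PreAbstractSimplicialComplex α) (d : ℕ) : Prop :=
  ∃ (φ : α → EuclideanSpace ℝ (Fin d))
    (L : Geometry.SimplicialComplex ℝ (EuclideanSpace ℝ (Fin d))),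
    Set.InjOn φ K.vertexSet ∧
    L.faces = {t : Finset (EuclideanSpace ℝ (Fin d)) |
      ∃ s ∈ K.faces, (t : Set (EuclideanSpace ℝ (Fin d))) = φ '' (s : Set α)}

/-- `H` is the hypergraph of the maximal faces of `K`, on the vertices of `K`. -/
def IsFacetHypergraph {α : Type*} (K : PreAbstractSimplicialComplex α) (H : Hypergraph α) : Prop :=
  H.vertexSet = K.vertexSet ∧
    H.edgeSet = {e | ∃ s : Finset α, Maximal (fun t => t ∈ K.faces) s ∧ (s : Set α) = e}

end PreAbstractSimplicialComplex

/-- `χ_L(k,d)`: the supremum of the weak chromatic numbers of the finite `k`-uniform hypergraphs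
that form the collection of maximal faces of a simplicial complex which is geometrically
embeddable in `ℝ^d`. -/
noncomputable def chiL (k d : ℕ) : ℕ∞ :=
  ⨆ (α : Type) (H : Hypergraph α) (_ : H.IsFinite ∧ H.IsUniform k ∧
    ∃ K : PreAbstractSimplicialComplex α, K.IsFacetHypergraph H ∧ K.GeometricallyEmbeddable d),
    H.weakChromaticNumber

/-! Each row and each column of a finite planar grid is placed in `ℝ^d` as an affine copy of the
moment curve. The hyperedges are the `(d+1)`-sets on one line whose nodal polynomial is nonnegative
at all vertices of that line. One dimension higher they would span lower faces of a cyclic polytope,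
so their projections to `ℝ^d` fit together as in a triangulation. Concretely, the difference of two
such nodal polynomials has degree at most `d`, hence comes from an affine function on `ℝ^d`, and it
separates the two simplices (`separatedBy_of_same_line`).

Parallel lines are separated by one dominant coordinate (`separatedBy_of_parallel`). A row and a
column bend in opposite directions, so some hyperplane has them on its two sides and touches them
only at their crossing (`exists_affineMap_crossing`). Pairwise separation yields both notions of
embedding.

For the coloring, put `m = (d+1)/2`, an integer because `d` is odd. Every block of the grid carries
a 5-cycle whose sides join consecutive vertices on a line. A 2-coloring leaves a monochromatic side
in each block, and the pigeonhole principle finds `m` disjoint such pairs of one color on one line.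
Their union satisfies Gale's evenness condition, so it is a monochromatic hyperedge
(`exists_monochromatic_gale_edge`). -/

section Convexity

/-! ### Separating hyperplanes and affine independence. -/

variable {E : Type*} [AddCommGroup E] [Module ℝ E]

/-- If an affine function is nonnegative on `A`, nonpositive on `B`, and vanishes on `A` only at
points of `B`, then the convex hulls of `A` and `B` meet in the convex hull of `A ∩ B`. -/
theorem convexHull_inter_subset_of_affine_separation [DecidableEq E] (A B : Finset E)
    (g : E →ᵃ[ℝ] ℝ) (hA : ∀ a ∈ A, 0 ≤ g a) (hB : ∀ b ∈ B, g b ≤ 0)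
    (hAB : ∀ a ∈ A, g a = 0 → a ∈ B) :
    convexHull ℝ (A : Set E) ∩ convexHull ℝ (B : Set E) ⊆
      convexHull ℝ ((A ∩ B : Finset E) : Set E) := by
  rintro z ⟨hzA, hzB⟩
  have hz : g z ≤ 0 := by
    have hconv : Convex ℝ {x | g x ≤ 0} := (convex_Iic (0 : ℝ)).affine_preimage g
    exact convexHull_min (fun b hb => hB b hb) hconv hzB
  obtain ⟨w, hw0, hw1, hwz⟩ := Finset.mem_convexHull'.1 hzA
  have hlin : ∀ x, g x = g.linear x + g 0 := fun x => congrFun g.decomp x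
  have hgz : g z = ∑ y ∈ A, w y * g y := by
    rw [hlin z, ← hwz, map_sum]
    simp_rw [map_smul, smul_eq_mul]
    have : g 0 = ∑ y ∈ A, w y * g 0 := by rw [← Finset.sum_mul, hw1, one_mul]
    rw [this, ← Finset.sum_add_distrib]
    refine Finset.sum_congr rfl fun y _ => ?_
    rw [hlin y]; ring
  have hnn : ∀ y ∈ A, 0 ≤ w y * g y := fun y hy => mul_nonneg (hw0 y hy) (hA y hy)
  -- The value `g z` is at most 0 and is a sum of nonnegative terms, so all weight sits on zeros of
  -- `g` in `A`, and these lie in `B`.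
  have hsum : ∑ y ∈ A, w y * g y = 0 := le_antisymm (hgz ▸ hz) (Finset.sum_nonneg hnn)
  have hzero := (Finset.sum_eq_zero_iff_of_nonneg hnn).1 hsum
  have hoff : ∀ y ∈ A, y ∉ A ∩ B → w y = 0 := by
    intro y hy hyB
    by_contra hne
    refine hyB (Finset.mem_inter.2 ⟨hy, hAB y hy ?_⟩)
    exact (mul_eq_zero.1 (hzero y hy)).resolve_left hne
  refine Finset.mem_convexHull'.2
    ⟨w, fun y hy => hw0 y (Finset.mem_inter.1 hy).1, ?_, ?_⟩
  · rw [← hw1]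
    exact Finset.sum_subset Finset.inter_subset_left hoff
  · rw [← hwz]
    refine Finset.sum_subset Finset.inter_subset_left fun y hy hyB => ?_
    rw [hoff y hy hyB, zero_smul]

/-- A family of points is affinely independent as soon as each of its points is the only one at
which some affine function does not vanish. -/
theorem affineIndependent_of_dual {ι : Type*} (p : ι → E)
    (h : ∀ i, ∃ g : E →ᵃ[ℝ] ℝ, g (p i) ≠ 0 ∧ ∀ j, j ≠ i → g (p j) = 0) :
    AffineIndependent ℝ p := by
  classical
  rw [affineIndependent_iff]
  intro s w hw hwp i hi
  obtain ⟨g, hgi, hgj⟩ := h i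
  have hlin : ∀ x, g x = g.linear x + g 0 := fun x => congrFun g.decomp x
  have hsum : ∑ e ∈ s, w e * g (p e) = 0 := by
    calc ∑ e ∈ s, w e * g (p e) = g.linear (∑ e ∈ s, w e • p e) + (∑ e ∈ s, w e) * g 0 := by
          rw [map_sum, Finset.sum_mul, ← Finset.sum_add_distrib]
          refine Finset.sum_congr rfl fun y _ => ?_
          rw [hlin, map_smul, smul_eq_mul]; ring
      _ = 0 := by rw [hwp, hw, map_zero, zero_mul, add_zero]
  rw [Finset.sum_eq_single_of_mem i hi (fun j _ hj => by rw [hgj j hj, mul_zero])] at hsum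
  exact (mul_eq_zero.1 hsum).resolve_right hgi

end Convexity

/-- The map `φ` places `e` and `f` on the two sides of a hyperplane, which contains no point of
`φ '' e` outside of `φ '' f`. -/
def SeparatedBy {α E : Type*} [AddCommGroup E] [Module ℝ E] (φ : α → E) (e f : Finset α) : Prop :=
  ∃ g : E →ᵃ[ℝ] ℝ, (∀ p ∈ e, 0 ≤ g (φ p)) ∧ (∀ q ∈ f, g (φ q) ≤ 0) ∧
    ∀ p ∈ e, g (φ p) = 0 → p ∈ f

theorem SeparatedBy.convexHull_inter_subset {α E : Type*} [AddCommGroup E] [Module ℝ E]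
    {φ : α → E} {e f : Finset α} (h : SeparatedBy φ e f) :
    convexHull ℝ (φ '' e) ∩ convexHull ℝ (φ '' f) ⊆ convexHull ℝ (φ '' e ∩ φ '' f) := by
  classical
  obtain ⟨g, he, hf, hef⟩ := h
  have := convexHull_inter_subset_of_affine_separation (e.image φ) (f.image φ) g
    (by simpa using he) (by simpa using hf)
    (by
      intro a ha h0
      obtain ⟨p, hp, rfl⟩ := Finset.mem_image.1 ha
      exact Finset.mem_image_of_mem φ (hef p hp h0))
  simpa only [Finset.coe_image, Finset.coe_inter] using this

/-! ### Complexes generated by pairwise separated simplices. -/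

/-- The hypergraph whose hyperedges are the members of `F`, on the vertices they cover. -/
def Hypergraph.ofFamily {α : Type*} (F : Set (Finset α)) : Hypergraph α where
  vertexSet := {p | ∃ e ∈ F, p ∈ e}
  edgeSet := {t | ∃ e ∈ F, (e : Set α) = t}
  subset_vertexSet_of_mem_edgeSet' := by
    rintro _ ⟨e, he, rfl⟩ p hp
    exact ⟨e, he, hp⟩

/-- The simplicial complex generated by `F`. -/
def PreAbstractSimplicialComplex.ofFamily {α : Type*} (F : Set (Finset α)) :
    PreAbstractSimplicialComplex α where
  faces := {s | s.Nonempty ∧ ∃ e ∈ F, s ⊆ e}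
  isRelLowerSet_faces := by
    rintro s ⟨hs, e, he, hse⟩
    exact ⟨hs, fun t hts ht => ⟨ht, e, he, hts.trans hse⟩⟩

theorem PreAbstractSimplicialComplex.vertexSet_ofFamily {α : Type*} (F : Set (Finset α)) :
    (PreAbstractSimplicialComplex.ofFamily F).vertexSet = (Hypergraph.ofFamily F).vertexSet := by
  ext p
  simp [PreAbstractSimplicialComplex.vertexSet, PreAbstractSimplicialComplex.ofFamily,
    Hypergraph.ofFamily]

theorem PreAbstractSimplicialComplex.isFacetHypergraph_ofFamily {α : Type*} (F : Set (Finset α))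
    {k : ℕ} (hF : ∀ e ∈ F, e.card = k + 1) :
    (PreAbstractSimplicialComplex.ofFamily F).IsFacetHypergraph (Hypergraph.ofFamily F) := by
  refine ⟨(PreAbstractSimplicialComplex.vertexSet_ofFamily F).symm, ?_⟩
  ext t
  constructor
  · rintro ⟨e, he, rfl⟩
    refine ⟨e, ⟨⟨Finset.card_pos.1 (by rw [hF e he]; omega), e, he, subset_rfl⟩, ?_⟩, rfl⟩
    rintro s ⟨-, f, hf, hsf⟩ hes
    have hef : e = f := Finset.eq_of_subset_of_card_le (hes.trans hsf) (by rw [hF e he, hF f hf])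
    exact hef ▸ hsf
  · rintro ⟨s, ⟨⟨hs, e, he, hse⟩, hmax⟩, rfl⟩
    have h : e ⊆ s := hmax ⟨hs.mono hse, e, he, subset_rfl⟩ hse
    exact ⟨e, he, by rw [subset_antisymm h hse]⟩

section Placement

variable {α : Type*} {F : Set (Finset α)} {d : ℕ} {φ : α → EuclideanSpace ℝ (Fin d)}

theorem convexHull_image_inter_of_separated
    (hsep : ∀ e ∈ F, ∀ f ∈ F, SeparatedBy φ e f ∨ SeparatedBy φ f e) {e f : Finset α}
    (he : e ∈ F) (hf : f ∈ F) :
    convexHull ℝ (φ '' e) ∩ convexHull ℝ (φ '' f) = convexHull ℝ (φ '' e ∩ φ '' f) := by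
  refine Set.Subset.antisymm ?_ (Set.subset_inter (convexHull_mono Set.inter_subset_left)
    (convexHull_mono Set.inter_subset_right))
  rcases hsep e he f hf with h | h
  · exact h.convexHull_inter_subset
  · rw [Set.inter_comm, Set.inter_comm (φ '' e)]
    exact h.convexHull_inter_subset

theorem affineIndependent_of_subset_image {e : Finset α}
    (hind : AffineIndependent ℝ (fun p : e => φ p)) {t : Finset (EuclideanSpace ℝ (Fin d))}
    (ht : (t : Set (EuclideanSpace ℝ (Fin d))) ⊆ φ '' e) :
    AffineIndependent ℝ ((↑) : t → EuclideanSpace ℝ (Fin d)) := by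
  have := hind.range
  rw [show Set.range (fun p : e => φ p) = φ '' e by ext; simp] at this
  exact this.mono ht

theorem Hypergraph.geometricallyEmbeddable_ofFamily
    (hF : ∀ e ∈ F, e.card = d + 1)
    (hinj : Set.InjOn φ (Hypergraph.ofFamily F).vertexSet)
    (hind : ∀ e ∈ F, AffineIndependent ℝ (fun p : e => φ p))
    (hsep : ∀ e ∈ F, ∀ f ∈ F, SeparatedBy φ e f ∨ SeparatedBy φ f e) :
    (Hypergraph.ofFamily F).GeometricallyEmbeddable (d + 1) d := by
  refine ⟨φ, hinj, ?_, ?_⟩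
  · rintro _ ⟨e, he, rfl⟩
    have h := (hind e he).finrank_vectorSpan (n := d) (by simp [hF e he])
    rw [show Set.range (fun p : e => φ p) = φ '' e by ext; simp] at h
    rw [direction_affineSpan, h]
  · rintro _ ⟨e, he, rfl⟩ _ ⟨f, hf, rfl⟩
    exact convexHull_image_inter_of_separated hsep he hf

/-- Separation only concerns the facets. It passes to their faces because, within an affinely
independent set, the hulls of two subsets meet in the hull of the intersection. -/
theorem PreAbstractSimplicialComplex.geometricallyEmbeddable_ofFamily
    (hinj : Set.InjOn φ (Hypergraph.ofFamily F).vertexSet)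
    (hind : ∀ e ∈ F, AffineIndependent ℝ (fun p : e => φ p))
    (hsep : ∀ e ∈ F, ∀ f ∈ F, SeparatedBy φ e f ∨ SeparatedBy φ f e) :
    (PreAbstractSimplicialComplex.ofFamily F).GeometricallyEmbeddable d := by
  classical
  have key : ∀ {t : Finset (EuclideanSpace ℝ (Fin d))},
      (∃ s ∈ (PreAbstractSimplicialComplex.ofFamily F).faces,
        (t : Set (EuclideanSpace ℝ (Fin d))) = φ '' (s : Set α)) →
      t.Nonempty ∧ ∃ e ∈ F, (t : Set (EuclideanSpace ℝ (Fin d))) ⊆ φ '' e := by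
    rintro t ⟨s, ⟨hs, e, he, hse⟩, hts⟩
    refine ⟨?_, e, he, hts ▸ Set.image_mono (by exact_mod_cast hse)⟩
    rw [← Finset.coe_nonempty, hts]
    exact (Finset.coe_nonempty.2 hs).image φ
  refine ⟨φ, ⟨⟨{t | ∃ s ∈ (PreAbstractSimplicialComplex.ofFamily F).faces,
      (t : Set (EuclideanSpace ℝ (Fin d))) = φ '' (s : Set α)}, ?_⟩, ?_, ?_⟩, ?_, rfl⟩
  · intro t ht
    obtain ⟨hne, -⟩ := key ht
    obtain ⟨s, ⟨hs, e, he, hse⟩, hts⟩ := ht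
    refine ⟨hne, fun u hut hu => ?_⟩
    refine ⟨s.filter (fun p => φ p ∈ u), ⟨?_, e, he, (Finset.filter_subset _ _).trans hse⟩, ?_⟩
    · obtain ⟨y, hy⟩ := hu
      have hy' : y ∈ (t : Set (EuclideanSpace ℝ (Fin d))) := hut hy
      rw [hts] at hy'
      obtain ⟨p, hp, rfl⟩ := hy'
      exact ⟨p, Finset.mem_filter.2 ⟨hp, hy⟩⟩
    · ext y
      constructor
      · intro hy
        have hy' : y ∈ (t : Set (EuclideanSpace ℝ (Fin d))) := hut hy
        rw [hts] at hy'
        obtain ⟨p, hp, rfl⟩ := hy'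
        exact ⟨p, by simpa using ⟨hp, hy⟩, rfl⟩
      · rintro ⟨p, hp, rfl⟩
        simpa using (Finset.mem_filter.1 hp).2
  · intro t ht
    obtain ⟨-, e, he, hte⟩ := key ht
    exact affineIndependent_of_subset_image (hind e he) hte
  · rintro t u ht hu
    obtain ⟨-, e, he, hte⟩ := key ht
    obtain ⟨-, f, hf, huf⟩ := key hu
    rintro z ⟨hzt, hzu⟩
    have hcoe : ∀ s : Finset α, ((s.image φ : Finset _) : Set _) = φ '' s := fun s =>
      Finset.coe_image
    have hz : z ∈ convexHull ℝ (φ '' e ∩ φ '' f) := by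
      rw [← convexHull_image_inter_of_separated hsep he hf]
      exact ⟨convexHull_mono hte hzt, convexHull_mono huf hzu⟩
    -- Intersect inside the simplex of `e` first, then inside that of `f`.
    have h1 : z ∈ convexHull ℝ ((t : Set _) ∩ φ '' f) := by
      have h := (affineIndependent_of_subset_image (hind e he) (hcoe e).subset).convexHull_inter
        (t₁ := t) (t₂ := e.image φ ∩ f.image φ)
        (by rw [← Finset.coe_subset, hcoe]; exact hte) Finset.inter_subset_left
      rw [Finset.coe_inter, hcoe, hcoe] at h
      refine convexHull_mono ?_ (h.symm.subset ⟨hzt, hz⟩)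
      exact fun x hx => ⟨hx.1, hx.2.2⟩
    have h := (affineIndependent_of_subset_image (hind f hf) (hcoe f).subset).convexHull_inter
        (t₁ := u) (t₂ := t ∩ f.image φ)
        (by rw [← Finset.coe_subset, hcoe]; exact huf) Finset.inter_subset_right
    rw [Finset.coe_inter, hcoe] at h
    refine convexHull_mono ?_ (h.symm.subset ⟨hzu, h1⟩)
    exact fun x hx => ⟨hx.2.1, hx.1⟩
  · rwa [PreAbstractSimplicialComplex.vertexSet_ofFamily]

end Placement

theorem Hypergraph.three_le_weakChromaticNumber {α : Type*} {H : Hypergraph α}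
    (h : ¬ H.WeaklyColorable 2) : 3 ≤ H.weakChromaticNumber := by
  refine le_iInf₂ fun m hm => ?_
  by_contra hlt
  have hm2 : m ≤ 2 := by
    have : m < 3 := by exact_mod_cast not_le.1 hlt
    omega
  obtain ⟨c, hc⟩ := hm
  refine h ⟨fun v => Fin.castLE hm2 (c v), fun e he => ?_⟩
  obtain ⟨u, v, hu, hv, huv⟩ := hc e he
  exact ⟨u, v, hu, hv, fun h' => huv (Fin.castLE_injective hm2 h')⟩

/-! ### The grid, its Gale edges and its placement. -/

/-- The point at position `x` of the line number `j`: a column if `v`, a row otherwise. -/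
def linePoint (v : Bool) (j x : ℕ) : ℕ × ℕ := if v then (j, x) else (x, j)

theorem linePoint_injective (v : Bool) (j : ℕ) : Function.Injective (linePoint v j) := by
  intro x y h
  cases v <;> simpa [linePoint] using h

/-- The `k`-subsets of `V` on a line that satisfy Gale's evenness condition with respect to the
points of `V` on this line. -/
def galeFamily (V : Finset (ℕ × ℕ)) (k : ℕ) : Set (Finset (ℕ × ℕ)) :=
  {e | e ⊆ V ∧ ∃ (v : Bool) (j : ℕ) (S : Finset ℕ), S.card = k ∧ e = S.image (linePoint v j) ∧
    ∀ x, linePoint v j x ∈ V → 0 ≤ ∏ s ∈ S, ((x : ℝ) - s)}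

theorem card_of_mem_galeFamily {V : Finset (ℕ × ℕ)} {k : ℕ} {e : Finset (ℕ × ℕ)}
    (he : e ∈ galeFamily V k) : e.card = k := by
  obtain ⟨-, v, j, S, hS, rfl, -⟩ := he
  rw [Finset.card_image_of_injective _ (linePoint_injective v j), hS]

/-- The coordinates of the placement of the grid: both the rows and the columns become moment
curves up to affine maps, the former bent upwards and the latter downwards. -/
def gridCoord (C : ℝ) : ℕ → ℝ → ℝ → ℝ
  | 0, x, y => C * x + y ^ 3
  | 1, x, y => C * y + x ^ 3
  | 2, x, y => x ^ 2 - y ^ 2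
  | k + 3, x, y => x ^ (k + 4) + y ^ (k + 4)

/-- The placement of the grid in `ℝ^d`. -/
noncomputable def gridPlacement (C : ℝ) (d : ℕ) (p : ℕ × ℕ) : EuclideanSpace ℝ (Fin d) :=
  WithLp.toLp 2 fun k => gridCoord C k p.1 p.2

theorem exists_affineMap_eq_gridCoord (C : ℝ) {d k : ℕ} (hk : k < d) :
    ∃ g : EuclideanSpace ℝ (Fin d) →ᵃ[ℝ] ℝ,
      ∀ p : ℕ × ℕ, g (gridPlacement C d p) = gridCoord C k p.1 p.2 :=
  ⟨(EuclideanSpace.proj (𝕜 := ℝ) (⟨k, hk⟩ : Fin d)).toLinearMap.toAffineMap, fun _ => rfl⟩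

/-- With the line fixed, the other grid coordinate is constant, so each coordinate of the placement
is a nonzero multiple of one power plus a constant, or is itself constant. The powers `1, ..., d`
all occur. -/
theorem exists_affineMap_eq_pow {C : ℝ} (hC : C ≠ 0) {d : ℕ} (hd : 3 ≤ d) (v : Bool) (j q : ℕ)
    (hq : q ≤ d) :
    ∃ g : EuclideanSpace ℝ (Fin d) →ᵃ[ℝ] ℝ,
      ∀ x : ℕ, g (gridPlacement C d (linePoint v j x)) = (x : ℝ) ^ q := by
  obtain ⟨g₀, h₀⟩ := exists_affineMap_eq_gridCoord C (show 0 < d by omega)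
  obtain ⟨g₁, h₁⟩ := exists_affineMap_eq_gridCoord C (show 1 < d by omega)
  obtain ⟨g₂, h₂⟩ := exists_affineMap_eq_gridCoord C (show 2 < d by omega)
  match q, hq with
  | 0, _ => exact ⟨AffineMap.const ℝ _ 1, fun x => by simp⟩
  | 1, _ =>
    cases v
    · refine ⟨C⁻¹ • (g₀ - AffineMap.const ℝ _ ((j : ℝ) ^ 3)), fun x => ?_⟩
      simp [h₀, linePoint, gridCoord, hC]
    · refine ⟨C⁻¹ • (g₁ - AffineMap.const ℝ _ ((j : ℝ) ^ 3)), fun x => ?_⟩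
      simp [h₁, linePoint, gridCoord, hC]
  | 2, _ =>
    cases v
    · refine ⟨g₂ + AffineMap.const ℝ _ ((j : ℝ) ^ 2), fun x => ?_⟩
      simp [h₂, linePoint, gridCoord]
    · refine ⟨AffineMap.const ℝ _ ((j : ℝ) ^ 2) - g₂, fun x => ?_⟩
      simp [h₂, linePoint, gridCoord]
  | 3, _ =>
    cases v
    · refine ⟨g₁ - AffineMap.const ℝ _ (C * j), fun x => ?_⟩
      simp [h₁, linePoint, gridCoord]
    · refine ⟨g₀ - AffineMap.const ℝ _ (C * j), fun x => ?_⟩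
      simp [h₀, linePoint, gridCoord]
  | k + 4, hk =>
    obtain ⟨g, h⟩ := exists_affineMap_eq_gridCoord C (show k + 3 < d by omega)
    refine ⟨g - AffineMap.const ℝ _ ((j : ℝ) ^ (k + 4)), fun x => ?_⟩
    cases v <;> simp [h, linePoint, gridCoord]

theorem exists_affineMap_eq_eval {C : ℝ} (hC : C ≠ 0) {d : ℕ} (hd : 3 ≤ d) (v : Bool) (j : ℕ)
    (P : Polynomial ℝ) (hP : P.natDegree < d + 1) :
    ∃ g : EuclideanSpace ℝ (Fin d) →ᵃ[ℝ] ℝ,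
      ∀ x : ℕ, g (gridPlacement C d (linePoint v j x)) = P.eval (x : ℝ) := by
  choose! g hg using exists_affineMap_eq_pow hC hd v j
  refine ⟨∑ q ∈ Finset.range (d + 1), P.coeff q • g q, fun x => ?_⟩
  have happ : ∀ (s : Finset ℕ) (z : EuclideanSpace ℝ (Fin d)),
      (∑ q ∈ s, P.coeff q • g q) z = ∑ q ∈ s, P.coeff q * g q z := by
    intro s z
    induction s using Finset.cons_induction with
    | empty => simp
    | cons a s ha ih =>
      rw [Finset.sum_cons, Finset.sum_cons, ← ih]
      simp
  rw [happ, Polynomial.eval_eq_sum_range' hP]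
  refine Finset.sum_congr rfl fun q hq => ?_
  rw [hg q (by simpa [Nat.lt_succ_iff] using hq)]

theorem affineIndependent_of_mem_galeFamily {C : ℝ} (hC : C ≠ 0) {d : ℕ} (hd : 3 ≤ d)
    {V : Finset (ℕ × ℕ)} {e : Finset (ℕ × ℕ)} (he : e ∈ galeFamily V (d + 1)) :
    AffineIndependent ℝ (fun p : e => gridPlacement C d p) := by
  obtain ⟨-, v, j, S, hS, rfl, -⟩ := he
  refine affineIndependent_of_dual _ ?_
  rintro ⟨p, hp⟩
  obtain ⟨x, hx, rfl⟩ := Finset.mem_image.1 hp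
  -- The dual function at `x` is the nodal polynomial of the other `d` nodes, whose degree `d` is
  -- just small enough.
  obtain ⟨g, hg⟩ := exists_affineMap_eq_eval hC hd v j
    (Lagrange.nodal (S.erase x) (fun s : ℕ => (s : ℝ)))
    (by rw [Lagrange.natDegree_nodal, Finset.card_erase_of_mem hx]; omega)
  refine ⟨g, ?_, ?_⟩
  · rw [hg, Lagrange.eval_nodal, Finset.prod_ne_zero_iff]
    intro s hs
    exact sub_ne_zero.2 (by exact_mod_cast (Finset.ne_of_mem_erase hs).symm)
  · rintro ⟨q, hq⟩ hne
    obtain ⟨y, hy, rfl⟩ := Finset.mem_image.1 hq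
    have hyx : y ≠ x := fun h => hne (by subst h; rfl)
    rw [hg]
    exact Lagrange.eval_nodal_at_node (Finset.mem_erase.2 ⟨hyx, hy⟩)

theorem natDegree_nodal_sub_nodal_lt {S T : Finset ℕ} {k : ℕ} (hS : S.card = k + 1)
    (hT : T.card = k + 1) :
    (Lagrange.nodal T (fun s : ℕ => (s : ℝ)) - Lagrange.nodal S (fun s : ℕ => (s : ℝ))).natDegree
      < k + 1 := by
  have hdeg : ∀ {R : Finset ℕ}, R.card = k + 1 →
      (Lagrange.nodal R (fun s : ℕ => (s : ℝ))).degree = (k + 1 : ℕ) := fun hR => by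
    rw [Lagrange.degree_nodal, hR]
  have h := Polynomial.degree_sub_lt_left ((hdeg hT).trans (hdeg hS).symm) Lagrange.nodal_ne_zero
    (by rw [Lagrange.nodal_monic, Lagrange.nodal_monic])
  rw [hdeg hT] at h
  by_cases h0 : Lagrange.nodal T (fun s : ℕ => (s : ℝ)) - Lagrange.nodal S (fun s : ℕ => (s : ℝ)) = 0
  · simp [h0]
  · exact (Polynomial.natDegree_lt_iff_degree_lt h0).2 h

/-- The nodal polynomial of `T` minus that of `S` loses its leading term. It restricts to the former
on `S` and to minus the latter on `T`, and the evenness condition gives the signs. -/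
theorem separatedBy_of_same_line {C : ℝ} (hC : C ≠ 0) {d : ℕ} (hd : 3 ≤ d)
    {V : Finset (ℕ × ℕ)} {v : Bool} {j : ℕ} {S T : Finset ℕ}
    (hS : S.card = d + 1) (hT : T.card = d + 1)
    (hSV : S.image (linePoint v j) ⊆ V) (hTV : T.image (linePoint v j) ⊆ V)
    (hS0 : ∀ x, linePoint v j x ∈ V → 0 ≤ ∏ s ∈ S, ((x : ℝ) - s))
    (hT0 : ∀ x, linePoint v j x ∈ V → 0 ≤ ∏ s ∈ T, ((x : ℝ) - s)) :
    SeparatedBy (gridPlacement C d) (S.image (linePoint v j)) (T.image (linePoint v j)) := by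
  obtain ⟨g, hg⟩ := exists_affineMap_eq_eval hC hd v j _ (natDegree_nodal_sub_nodal_lt hS hT)
  have hgS : ∀ x ∈ S, g (gridPlacement C d (linePoint v j x)) = ∏ s ∈ T, ((x : ℝ) - s) := by
    intro x hx
    rw [hg, Polynomial.eval_sub, Lagrange.eval_nodal_at_node hx, sub_zero, Lagrange.eval_nodal]
  have hgT : ∀ x ∈ T, g (gridPlacement C d (linePoint v j x)) = -∏ s ∈ S, ((x : ℝ) - s) := by
    intro x hx
    rw [hg, Polynomial.eval_sub, Lagrange.eval_nodal_at_node hx, zero_sub, Lagrange.eval_nodal]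
  refine ⟨g, ?_, ?_, ?_⟩
  · intro p hp
    obtain ⟨x, hx, rfl⟩ := Finset.mem_image.1 hp
    rw [hgS x hx]
    exact hT0 x (hSV hp)
  · intro p hp
    obtain ⟨x, hx, rfl⟩ := Finset.mem_image.1 hp
    rw [hgT x hx]
    exact neg_nonpos.2 (hS0 x (hTV hp))
  · intro p hp h0
    obtain ⟨x, hx, rfl⟩ := Finset.mem_image.1 hp
    rw [hgS x hx, Finset.prod_eq_zero_iff] at h0
    obtain ⟨s, hs, hxs⟩ := h0
    have : x = s := by exact_mod_cast sub_eq_zero.1 hxs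
    exact Finset.mem_image_of_mem _ (this ▸ hs)

/-- The coordinate `C * l + x ^ 3` is dominated by the line number `l`, since `C > N ^ 3`. -/
theorem separatedBy_of_parallel {N d : ℕ} (hd : 3 ≤ d) {v : Bool} {i j : ℕ} (hij : i < j)
    {S T : Finset ℕ} (hS : ∀ x ∈ S, x < N) :
    SeparatedBy (gridPlacement (6 * (N : ℝ) ^ 3 + 1) d) (S.image (linePoint v i))
      (T.image (linePoint v j)) := by
  set C : ℝ := 6 * (N : ℝ) ^ 3 + 1 with hC
  have hC0 : 0 ≤ C := by positivity
  obtain ⟨g, hg⟩ : ∃ g : EuclideanSpace ℝ (Fin d) →ᵃ[ℝ] ℝ,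
      ∀ l x : ℕ, g (gridPlacement C d (linePoint v l x)) = C * l + (x : ℝ) ^ 3 := by
    cases v
    · obtain ⟨g, h⟩ := exists_affineMap_eq_gridCoord C (show 1 < d by omega)
      exact ⟨g, fun l x => h _⟩
    · obtain ⟨g, h⟩ := exists_affineMap_eq_gridCoord C (show 0 < d by omega)
      exact ⟨g, fun l x => h _⟩
  have hpos : ∀ x ∈ S, 0 < C * j - (C * i + (x : ℝ) ^ 3) := by
    intro x hx
    have hx3 : (x : ℝ) ^ 3 ≤ (N : ℝ) ^ 3 := by
      have : (x : ℝ) ≤ N := by exact_mod_cast (hS x hx).le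
      gcongr
    have hij' : (i : ℝ) + 1 ≤ j := by exact_mod_cast hij
    have h1 : C * (i + 1) ≤ C * j := mul_le_mul_of_nonneg_left hij' hC0
    have hN : (0 : ℝ) ≤ (N : ℝ) ^ 3 := by positivity
    linarith
  refine ⟨AffineMap.const ℝ _ (C * j) - g, ?_, ?_, ?_⟩
  · intro p hp
    obtain ⟨x, hx, rfl⟩ := Finset.mem_image.1 hp
    simpa [hg] using (hpos x hx).le
  · intro p hp
    obtain ⟨x, hx, rfl⟩ := Finset.mem_image.1 hp
    simp [hg]
  · intro p hp h0
    obtain ⟨x, hx, rfl⟩ := Finset.mem_image.1 hp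
    have := hpos x hx
    simp [hg] at h0
    linarith

theorem sq_le_quadratic_add_cubic {N x i j : ℕ} (hx : x ≤ N) (hi : i ≤ N) (hj : j ≤ N) :
    ((x : ℝ) - i) ^ 2 ≤
      (6 * (N : ℝ) ^ 3 + 1) * ((x : ℝ) - i) ^ 2 + 2 * j * ((x : ℝ) ^ 3 - (i : ℝ) ^ 3) := by
  have hx' : (x : ℝ) ≤ N := by exact_mod_cast hx
  have hi' : (i : ℝ) ≤ N := by exact_mod_cast hi
  have hj' : (j : ℝ) ≤ N := by exact_mod_cast hj
  set r : ℝ := 2 * j * ((x : ℝ) ^ 2 + x * i + (i : ℝ) ^ 2) with hr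
  have hr0 : 0 ≤ r := by positivity
  have hrN : r ≤ 6 * (N : ℝ) ^ 3 := by
    calc r ≤ 2 * N * ((N : ℝ) ^ 2 + N * N + (N : ℝ) ^ 2) := by rw [hr]; gcongr
      _ = 6 * (N : ℝ) ^ 3 := by ring
  -- This needs integrality: a nonzero integer is at most its square in absolute value.
  have hu : -((x : ℝ) - i) ≤ ((x : ℝ) - i) ^ 2 := by
    have : -((x : ℤ) - i) ≤ ((x : ℤ) - i) ^ 2 := by
      rcases le_or_gt 0 ((x : ℤ) - i) with h | h <;> nlinarith
    exact_mod_cast this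
  have h1 : r * -((x : ℝ) - i) ≤ r * ((x : ℝ) - i) ^ 2 := mul_le_mul_of_nonneg_left hu hr0
  have h2 : r * ((x : ℝ) - i) ^ 2 ≤ 6 * (N : ℝ) ^ 3 * ((x : ℝ) - i) ^ 2 :=
    mul_le_mul_of_nonneg_right hrN (sq_nonneg _)
  have h3 : 2 * j * ((x : ℝ) ^ 3 - (i : ℝ) ^ 3) = r * ((x : ℝ) - i) := by rw [hr]; ring
  linarith

theorem exists_affineMap_crossing {N d i j : ℕ} (hd : 3 ≤ d) (hi : i ≤ N) (hj : j ≤ N) :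
    ∃ g : EuclideanSpace ℝ (Fin d) →ᵃ[ℝ] ℝ,
      (∀ x : ℕ, x ≤ N →
        ((x : ℝ) - i) ^ 2 ≤ g (gridPlacement (6 * (N : ℝ) ^ 3 + 1) d (linePoint false j x))) ∧
      ∀ y : ℕ, y ≤ N →
        g (gridPlacement (6 * (N : ℝ) ^ 3 + 1) d (linePoint true i y)) ≤ -((y : ℝ) - j) ^ 2 := by
  set C : ℝ := 6 * (N : ℝ) ^ 3 + 1 with hC
  obtain ⟨g₀, h₀⟩ := exists_affineMap_eq_gridCoord C (show 0 < d by omega)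
  obtain ⟨g₁, h₁⟩ := exists_affineMap_eq_gridCoord C (show 1 < d by omega)
  obtain ⟨g₂, h₂⟩ := exists_affineMap_eq_gridCoord C (show 2 < d by omega)
  -- On the row this function equals `C (x - i)² + 2j (x³ - i³)`, and on the column `-(C (y - j)² +
  -- 2i (y³ - j³))`. The large `C` absorbs the cubic terms.
  refine ⟨C • g₂ - (2 * (i : ℝ)) • g₀ + (2 * (j : ℝ)) • g₁ +
    AffineMap.const ℝ _ (C * ((i : ℝ) ^ 2 - (j : ℝ) ^ 2) + 2 * i * (j : ℝ) ^ 3 - 2 * j * (i : ℝ) ^ 3),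
    ?_, ?_⟩
  · intro x hx
    have h := sq_le_quadratic_add_cubic hx hi hj
    rw [← hC] at h
    refine h.trans_eq ?_
    simp [h₀, h₁, h₂, linePoint, gridCoord]
    ring
  · intro y hy
    have h := neg_le_neg (sq_le_quadratic_add_cubic hy hj hi)
    rw [← hC] at h
    refine Eq.trans_le ?_ h
    simp [h₀, h₁, h₂, linePoint, gridCoord]
    ring

theorem separatedBy_or_of_crossing {N d i j : ℕ} (hd : 3 ≤ d) (hi : i ≤ N) (hj : j ≤ N)
    {S T : Finset ℕ} (hS : ∀ x ∈ S, x ≤ N) (hT : ∀ y ∈ T, y ≤ N) :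
    SeparatedBy (gridPlacement (6 * (N : ℝ) ^ 3 + 1) d) (S.image (linePoint false j))
        (T.image (linePoint true i)) ∨
      SeparatedBy (gridPlacement (6 * (N : ℝ) ^ 3 + 1) d) (T.image (linePoint true i))
        (S.image (linePoint false j)) := by
  obtain ⟨g, hgS, hgT⟩ := exists_affineMap_crossing hd hi hj
  have hS0 : ∀ p ∈ S.image (linePoint false j),
      0 ≤ g (gridPlacement (6 * (N : ℝ) ^ 3 + 1) d p) := by
    intro p hp
    obtain ⟨x, hx, rfl⟩ := Finset.mem_image.1 hp
    exact (sq_nonneg _).trans (hgS x (hS x hx))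
  have hT0 : ∀ p ∈ T.image (linePoint true i),
      g (gridPlacement (6 * (N : ℝ) ^ 3 + 1) d p) ≤ 0 := by
    intro p hp
    obtain ⟨x, hx, rfl⟩ := Finset.mem_image.1 hp
    exact (hgT x (hT x hx)).trans (neg_nonpos.2 (sq_nonneg _))
  have hSij : ∀ p ∈ S.image (linePoint false j),
      g (gridPlacement (6 * (N : ℝ) ^ 3 + 1) d p) = 0 → p = (i, j) := by
    intro p hp h0
    obtain ⟨x, hx, rfl⟩ := Finset.mem_image.1 hp
    have hxi := (h0 ▸ hgS x (hS x hx) : ((x : ℝ) - i) ^ 2 ≤ 0)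
    have : x = i := by
      exact_mod_cast sub_eq_zero.1 (pow_eq_zero_iff two_ne_zero |>.1 (hxi.antisymm (sq_nonneg _)))
    simp [linePoint, this]
  have hTij : ∀ p ∈ T.image (linePoint true i),
      g (gridPlacement (6 * (N : ℝ) ^ 3 + 1) d p) = 0 → p = (i, j) := by
    intro p hp h0
    obtain ⟨x, hx, rfl⟩ := Finset.mem_image.1 hp
    have hxj := (h0 ▸ hgT x (hT x hx) : 0 ≤ -((x : ℝ) - j) ^ 2)
    have : x = j := by
      exact_mod_cast sub_eq_zero.1
        (pow_eq_zero_iff two_ne_zero |>.1 ((neg_nonneg.1 hxj).antisymm (sq_nonneg _)))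
    simp [linePoint, this]
  -- Contact is possible only at the crossing point. If `T` misses it, the side of `T` is strictly
  -- separated, so the roles are exchanged.
  by_cases hmem : (i, j) ∈ T.image (linePoint true i)
  · exact Or.inl ⟨g, hS0, hT0, fun p hp h0 => hSij p hp h0 ▸ hmem⟩
  · refine Or.inr ⟨-g, fun p hp => ?_, fun p hp => ?_, fun p hp h0 => ?_⟩
    · simpa using hT0 p hp
    · simpa using hS0 p hp
    · exact absurd (hTij p hp (by simpa using h0) ▸ hp) hmem

section Grid

variable {N d : ℕ} {V : Finset (ℕ × ℕ)}

theorem position_lt_of_image_subset (hV : V ⊆ Finset.range N ×ˢ Finset.range N) {v : Bool} {j : ℕ}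
    {S : Finset ℕ} (hS : S.image (linePoint v j) ⊆ V) : ∀ x ∈ S, x < N ∧ j < N := by
  intro x hx
  have := hV (hS (Finset.mem_image_of_mem _ hx))
  cases v <;> simp [linePoint] at this <;> tauto

theorem separatedBy_or_of_mem_galeFamily (hd : 3 ≤ d)
    (hV : V ⊆ Finset.range N ×ˢ Finset.range N) {e f : Finset (ℕ × ℕ)}
    (he : e ∈ galeFamily V (d + 1)) (hf : f ∈ galeFamily V (d + 1)) :
    SeparatedBy (gridPlacement (6 * (N : ℝ) ^ 3 + 1) d) e f ∨
      SeparatedBy (gridPlacement (6 * (N : ℝ) ^ 3 + 1) d) f e := by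
  have hC : (6 * (N : ℝ) ^ 3 + 1) ≠ 0 := by positivity
  obtain ⟨heV, v, i, S, hS, rfl, hS0⟩ := he
  obtain ⟨hfV, w, j, T, hT, rfl, hT0⟩ := hf
  have hSN := position_lt_of_image_subset hV heV
  have hTN := position_lt_of_image_subset hV hfV
  obtain ⟨s, hs⟩ : S.Nonempty := Finset.card_pos.1 (by omega)
  obtain ⟨t, ht⟩ : T.Nonempty := Finset.card_pos.1 (by omega)
  have hi := (hSN s hs).2.le
  have hj := (hTN t ht).2.le
  rcases eq_or_ne v w with rfl | hvw
  · rcases lt_trichotomy i j with h | rfl | h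
    · exact Or.inl (separatedBy_of_parallel hd h fun x hx => (hSN x hx).1)
    · exact Or.inl (separatedBy_of_same_line hC hd hS hT heV hfV hS0 hT0)
    · exact Or.inr (separatedBy_of_parallel hd h fun x hx => (hTN x hx).1)
  · cases v <;> cases w
    · exact absurd rfl hvw
    · exact separatedBy_or_of_crossing hd hj hi (fun x hx => (hSN x hx).1.le)
        fun x hx => (hTN x hx).1.le
    · exact (separatedBy_or_of_crossing hd hi hj (fun x hx => (hTN x hx).1.le)
        fun x hx => (hSN x hx).1.le).symm
    · exact absurd rfl hvw

theorem eq_of_mul_add_cube_eq {a a' b b' : ℕ} (hb : b < N) (hb' : b' < N)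
    (h : (6 * (N : ℝ) ^ 3 + 1) * a + (b : ℝ) ^ 3 = (6 * (N : ℝ) ^ 3 + 1) * a' + (b' : ℝ) ^ 3) :
    a = a' := by
  have h' : (6 * N ^ 3 + 1) * a + b ^ 3 = (6 * N ^ 3 + 1) * a' + b' ^ 3 := by exact_mod_cast h
  have h1 : b ^ 3 ≤ N ^ 3 := Nat.pow_le_pow_left hb.le 3
  have h2 : b' ^ 3 ≤ N ^ 3 := Nat.pow_le_pow_left hb'.le 3
  by_contra hne
  rcases lt_or_gt_of_ne hne with h3 | h3
  · have := Nat.mul_le_mul_left (6 * N ^ 3 + 1) (Nat.succ_le_of_lt h3)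
    rw [Nat.succ_eq_add_one, mul_add] at this
    omega
  · have := Nat.mul_le_mul_left (6 * N ^ 3 + 1) (Nat.succ_le_of_lt h3)
    rw [Nat.succ_eq_add_one, mul_add] at this
    omega

theorem injOn_gridPlacement (hd : 3 ≤ d) :
    Set.InjOn (gridPlacement (6 * (N : ℝ) ^ 3 + 1) d)
      (Finset.range N ×ˢ Finset.range N : Finset (ℕ × ℕ)) := by
  rintro ⟨x, y⟩ hp ⟨x', y'⟩ hq h
  simp only [Finset.coe_product, Finset.coe_range, Set.mem_prod, Set.mem_Iio] at hp hq
  obtain ⟨g₀, h₀⟩ := exists_affineMap_eq_gridCoord (6 * (N : ℝ) ^ 3 + 1) (show 0 < d by omega)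
  obtain ⟨g₁, h₁⟩ := exists_affineMap_eq_gridCoord (6 * (N : ℝ) ^ 3 + 1) (show 1 < d by omega)
  have hx := (h₀ (x, y)).symm.trans ((congrArg g₀ h).trans (h₀ (x', y')))
  have hy := (h₁ (x, y)).symm.trans ((congrArg g₁ h).trans (h₁ (x', y')))
  exact Prod.ext (eq_of_mul_add_cube_eq hp.2 hq.2 hx) (eq_of_mul_add_cube_eq hp.1 hq.1 hy)

theorem vertexSet_ofFamily_galeFamily_subset {k : ℕ} :
    (Hypergraph.ofFamily (galeFamily V k)).vertexSet ⊆ V := by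
  rintro p ⟨e, he, hp⟩
  exact he.1 hp

end Grid

/-! ### Monochromatic edges in every 2-coloring. -/

/-- If the gale edges of `V` are not monochromatic, then no line contains `m` disjoint pairs of
consecutive points of `V` that all have the same color. -/
theorem false_of_monochromatic_pairs {V : Finset (ℕ × ℕ)} {m : ℕ} {K : Type*} {c : ℕ × ℕ → K}
    (hc : ∀ e ∈ galeFamily V (2 * m), ∃ p ∈ e, ∃ q ∈ e, c p ≠ c q) {ι : Type*} (I : Finset ι)
    (hI : I.card = m) (v : Bool) (j : ℕ) (k : K) (u w : ι → ℕ) (hu : Set.InjOn u I)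
    (hw : Set.InjOn w I) (huw : ∀ a ∈ I, ∀ b ∈ I, u a ≠ w b)
    (huV : ∀ a ∈ I, linePoint v j (u a) ∈ V) (hwV : ∀ a ∈ I, linePoint v j (w a) ∈ V)
    (hgap : ∀ a ∈ I, ∀ x, linePoint v j x ∈ V → x ≤ u a ∧ x ≤ w a ∨ u a ≤ x ∧ w a ≤ x)
    (hcu : ∀ a ∈ I, c (linePoint v j (u a)) = k) (hcw : ∀ a ∈ I, c (linePoint v j (w a)) = k) :
    False := by
  have hdisj : Disjoint (I.image u) (I.image w) := by
    rw [Finset.disjoint_left]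
    intro x hx hx'
    obtain ⟨a, ha, rfl⟩ := Finset.mem_image.1 hx
    obtain ⟨b, hb, hab⟩ := Finset.mem_image.1 hx'
    exact huw a ha b hb hab.symm
  have hmem : ∀ p ∈ (I.image u ∪ I.image w).image (linePoint v j), p ∈ V ∧ c p = k := by
    intro p hp
    obtain ⟨x, hx, rfl⟩ := Finset.mem_image.1 hp
    rcases Finset.mem_union.1 hx with hx | hx
    · obtain ⟨a, ha, rfl⟩ := Finset.mem_image.1 hx
      exact ⟨huV a ha, hcu a ha⟩
    · obtain ⟨a, ha, rfl⟩ := Finset.mem_image.1 hx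
      exact ⟨hwV a ha, hcw a ha⟩
  obtain ⟨p, hp, q, hq, hpq⟩ := hc ((I.image u ∪ I.image w).image (linePoint v j))
    ⟨fun p hp => (hmem p hp).1, v, j, I.image u ∪ I.image w, by
      rw [Finset.card_union_of_disjoint hdisj, Finset.card_image_of_injOn hu,
        Finset.card_image_of_injOn hw, hI, two_mul], rfl, fun x hx => by
      rw [Finset.prod_union hdisj, Finset.prod_image hu, Finset.prod_image hw,
        ← Finset.prod_mul_distrib]
      refine Finset.prod_nonneg fun a ha => ?_
      rcases hgap a ha x hx with h | h
      · exact mul_nonneg_of_nonpos_of_nonpos (sub_nonpos.2 (by exact_mod_cast h.1))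
          (sub_nonpos.2 (by exact_mod_cast h.2))
      · exact mul_nonneg (sub_nonneg.2 (by exact_mod_cast h.1))
          (sub_nonneg.2 (by exact_mod_cast h.2))⟩
  exact hpq ((hmem p hp).2.trans (hmem q hq).2.symm)

/-- The part of the `3n × 2n` grid in which every block of size `3 × 2` misses the middle point of
its upper row, so that the other five points form a pentagon of consecutive points. -/
def pentagonGrid (n : ℕ) : Finset (ℕ × ℕ) :=
  {p ∈ Finset.range (3 * n) ×ˢ Finset.range (2 * n) | ¬ (p.1 % 3 = 1 ∧ p.2 % 2 = 1)}

theorem mem_pentagonGrid {n x y : ℕ} :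
    (x, y) ∈ pentagonGrid n ↔ (x < 3 * n ∧ y < 2 * n) ∧ ¬ (x % 3 = 1 ∧ y % 2 = 1) := by
  simp [pentagonGrid]

theorem pentagonGrid_subset (n : ℕ) :
    pentagonGrid n ⊆ Finset.range (3 * n) ×ˢ Finset.range (3 * n) := by
  rintro ⟨x, y⟩ h
  rw [mem_pentagonGrid] at h
  simp only [Finset.mem_product, Finset.mem_range]
  omega

/-- The direction of the side number `κ` of the pentagons. -/
def sideDir (κ : Fin 5) : Bool := ![false, false, false, true, true] κ

/-- The line that contains the side number `κ` of the pentagon in block `p`. -/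
def sideLine (κ : Fin 5) (p : ℕ × ℕ) : ℕ :=
  ![2 * p.2, 2 * p.2, 2 * p.2 + 1, 3 * p.1, 3 * p.1 + 2] κ

/-- The position of the first end of the side number `κ` of the pentagon in block `p`. -/
def sideFst (κ : Fin 5) (p : ℕ × ℕ) : ℕ :=
  ![3 * p.1, 3 * p.1 + 1, 3 * p.1, 2 * p.2, 2 * p.2] κ

/-- The position of the second end of the side number `κ` of the pentagon in block `p`. -/
def sideSnd (κ : Fin 5) (p : ℕ × ℕ) : ℕ :=
  ![3 * p.1 + 1, 3 * p.1 + 2, 3 * p.1 + 2, 2 * p.2 + 1, 2 * p.2 + 1] κ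

theorem exists_monochromatic_side (c : ℕ × ℕ → Fin 2) (p : ℕ × ℕ) :
    ∃ κ : Fin 5, c (linePoint (sideDir κ) (sideLine κ p) (sideFst κ p)) =
      c (linePoint (sideDir κ) (sideLine κ p) (sideSnd κ p)) := by
  -- The five equalities run over the sides of a 5-cycle, which is not 2-colorable.
  have key : ∀ x₀ x₁ x₂ x₃ x₄ : Fin 2,
      x₀ = x₁ ∨ x₁ = x₂ ∨ x₃ = x₄ ∨ x₀ = x₃ ∨ x₂ = x₄ := by decide
  rcases key (c (3 * p.1, 2 * p.2)) (c (3 * p.1 + 1, 2 * p.2)) (c (3 * p.1 + 2, 2 * p.2))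
    (c (3 * p.1, 2 * p.2 + 1)) (c (3 * p.1 + 2, 2 * p.2 + 1)) with h | h | h | h | h
  · exact ⟨0, h⟩
  · exact ⟨1, h⟩
  · exact ⟨2, h⟩
  · exact ⟨3, h⟩
  · exact ⟨4, h⟩

theorem exists_monochromatic_gale_edge {m : ℕ} (hm : 0 < m) (c : ℕ × ℕ → Fin 2) :
    ∃ e ∈ galeFamily (pentagonGrid (30 * m)) (2 * m), ∀ p ∈ e, ∀ q ∈ e, c p = c q := by
  by_contra! hc
  choose κ hκ using exists_monochromatic_side c
  set n := 30 * m with hn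
  have hmaps : ∀ p ∈ Finset.range n ×ˢ Finset.range n,
      (κ p, c (linePoint (sideDir (κ p)) (sideLine (κ p) p) (sideFst (κ p) p)), sideLine (κ p) p) ∈
        (Finset.univ : Finset (Fin 5)) ×ˢ (Finset.univ : Finset (Fin 2)) ×ˢ
          Finset.range (3 * n) := by
    rintro ⟨a, b⟩ hp
    simp only [Finset.mem_product, Finset.mem_range, Finset.mem_univ, true_and] at hp ⊢
    generalize κ (a, b) = i
    fin_cases i <;> simp [sideLine] <;> omega
  -- There are `n² = 30 m n` blocks but at most `5 · 2 · 3n = 30n` labels (side, color, line), so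
  -- some label occurs more than `m - 1` times.
  obtain ⟨⟨i, k, j⟩, -, hcard⟩ := Finset.exists_lt_card_fiber_of_mul_lt_card_of_maps_to
    (n := m - 1) hmaps (by
      simp only [Finset.card_product, Finset.card_univ, Fintype.card_fin, Finset.card_range]
      obtain ⟨l, rfl⟩ : ∃ l, m = l + 1 := ⟨m - 1, by omega⟩
      rw [hn, Nat.add_sub_cancel]
      nlinarith)
  obtain ⟨I, hIs, hI⟩ := Finset.exists_subset_card_eq (Nat.le_of_pred_lt hcard)
  have hmem : ∀ p ∈ I, (p.1 < n ∧ p.2 < n) ∧ sideLine i p = j ∧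
      c (linePoint (sideDir i) j (sideFst i p)) = k ∧
      c (linePoint (sideDir i) j (sideSnd i p)) = k := by
    intro p hp
    have h := hIs hp
    simp only [Finset.mem_filter, Finset.mem_product, Finset.mem_range, Prod.mk.injEq] at h
    obtain ⟨hpn, rfl, rfl, rfl⟩ := h
    exact ⟨hpn, rfl, rfl, (hκ p).symm⟩
  refine false_of_monochromatic_pairs hc I hI (sideDir i) j k (sideFst i) (sideSnd i) ?_ ?_ ?_ ?_ ?_
    ?_ (fun p hp => (hmem p hp).2.2.1) (fun p hp => (hmem p hp).2.2.2)
  · rintro ⟨a, b⟩ hp ⟨a', b'⟩ hq h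
    have h1 := (hmem _ hp).2.1
    have h2 := (hmem _ hq).2.1
    clear hmem hIs hcard
    fin_cases i <;> simp [sideLine, sideFst] at h h1 h2 ⊢ <;> omega
  · rintro ⟨a, b⟩ hp ⟨a', b'⟩ hq h
    have h1 := (hmem _ hp).2.1
    have h2 := (hmem _ hq).2.1
    clear hmem hIs hcard
    fin_cases i <;> simp [sideLine, sideSnd] at h h1 h2 ⊢ <;> omega
  · rintro ⟨a, b⟩ hp ⟨a', b'⟩ hq
    clear hmem hIs hcard
    fin_cases i <;> simp [sideFst, sideSnd] <;> omega
  · rintro ⟨a, b⟩ hp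
    obtain ⟨hab, h1, -⟩ := hmem _ hp
    clear hmem hIs hcard
    fin_cases i <;> simp [sideLine, sideDir, sideFst, linePoint, mem_pentagonGrid] at h1 hab ⊢ <;>
      omega
  · rintro ⟨a, b⟩ hp
    obtain ⟨hab, h1, -⟩ := hmem _ hp
    clear hmem hIs hcard
    fin_cases i <;> simp [sideLine, sideDir, sideSnd, linePoint, mem_pentagonGrid] at h1 hab ⊢ <;>
      omega
  -- The ends of side 2 are two apart; they are consecutive in the grid because the point between
  -- them was removed.
  · rintro ⟨a, b⟩ hp x hx
    obtain ⟨hab, h1, -⟩ := hmem _ hp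
    clear hmem hIs hcard
    fin_cases i <;>
      simp [sideLine, sideDir, sideFst, sideSnd, linePoint, mem_pentagonGrid] at h1 hab hx ⊢ <;>
      omega

theorem not_weaklyColorable_two_pentagonGrid {m : ℕ} (hm : 0 < m) :
    ¬ (Hypergraph.ofFamily (galeFamily (pentagonGrid (30 * m)) (2 * m))).WeaklyColorable 2 := by
  classical
  rintro ⟨c, hc⟩
  -- The color 0 off the vertex set is harmless, since all points of a hyperedge are vertices.
  obtain ⟨e, he, hmono⟩ := exists_monochromatic_gale_edge hm fun p =>
    if h : p ∈ (Hypergraph.ofFamily (galeFamily (pentagonGrid (30 * m)) (2 * m))).vertexSet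
    then c ⟨p, h⟩ else 0
  obtain ⟨u, v, hu, hv, huv⟩ := hc e ⟨e, he, rfl⟩
  have := hmono u hu v hv
  rw [dif_pos u.2, dif_pos v.2] at this
  exact huv this

theorem theoremC (d : ℕ) (hd : Odd d) (hd3 : 3 ≤ d) :
    3 ≤ chiL (d + 1) d ∧
      ∃ (α : Type) (L : Hypergraph α), L.IsFinite ∧ L.IsUniform (d + 1) ∧
        L.GeometricallyEmbeddable (d + 1) d ∧ ¬ L.WeaklyColorable 2 := by
  obtain ⟨l, hl⟩ := hd
  have hm : d + 1 = 2 * (l + 1) := by omega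
  set n := 30 * (l + 1) with hn
  set F := galeFamily (pentagonGrid n) (d + 1) with hF
  have hcard : ∀ e ∈ F, e.card = d + 1 := fun e he => card_of_mem_galeFamily he
  have hC : (6 * ((3 * n : ℕ) : ℝ) ^ 3 + 1) ≠ 0 := by positivity
  have hinj : Set.InjOn (gridPlacement (6 * ((3 * n : ℕ) : ℝ) ^ 3 + 1) d)
      (Hypergraph.ofFamily F).vertexSet :=
    (injOn_gridPlacement hd3).mono
      (vertexSet_ofFamily_galeFamily_subset.trans (by exact_mod_cast pentagonGrid_subset n))
  have hind : ∀ e ∈ F, AffineIndependent ℝ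
      (fun p : e => gridPlacement (6 * ((3 * n : ℕ) : ℝ) ^ 3 + 1) d p) :=
    fun e he => affineIndependent_of_mem_galeFamily hC hd3 he
  have hsep : ∀ e ∈ F, ∀ f ∈ F, SeparatedBy (gridPlacement (6 * ((3 * n : ℕ) : ℝ) ^ 3 + 1) d) e f ∨
      SeparatedBy (gridPlacement (6 * ((3 * n : ℕ) : ℝ) ^ 3 + 1) d) f e :=
    fun e he f hf => separatedBy_or_of_mem_galeFamily hd3 (pentagonGrid_subset n) he hf
  have hfin : (Hypergraph.ofFamily F).IsFinite :=
    (pentagonGrid n).finite_toSet.subset vertexSet_ofFamily_galeFamily_subset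
  have hunif : (Hypergraph.ofFamily F).IsUniform (d + 1) := by
    rintro _ ⟨e, he, rfl⟩
    rw [Set.encard_coe_eq_coe_finsetCard, hcard e he]
  have hcol : ¬ (Hypergraph.ofFamily F).WeaklyColorable 2 := by
    rw [hF, hm]
    exact not_weaklyColorable_two_pentagonGrid l.succ_pos
  refine ⟨?_, ℕ × ℕ, Hypergraph.ofFamily F, hfin, hunif,
    Hypergraph.geometricallyEmbeddable_ofFamily hcard hinj hind hsep, hcol⟩
  refine (Hypergraph.three_le_weakChromaticNumber hcol).trans ?_
  refine le_iSup_of_le (ℕ × ℕ) (le_iSup_of_le (Hypergraph.ofFamily F) (le_iSup_of_le ?_ le_rfl))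
  exact ⟨hfin, hunif, _, PreAbstractSimplicialComplex.isFacetHypergraph_ofFamily F hcard,
    PreAbstractSimplicialComplex.geometricallyEmbeddable_ofFamily hinj hind hsep⟩
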